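/- Let $k$ be a field of characteristic zero. Let $A$ be a finite-dimensional semisimple (associative, unital) $k$-algebra (when $k$ is algebraically closed, these are the algebras that correspond to two-dimensional lattice topological field theories). Let $X$ be a finite alphabet with free monoid $X^*$, and let $S\colon X^*\to k$ be a formal series with syntactic algebra $\mathfrak A_S\cong A$. Then $S$ is definable by a sentence of restricted weighted monadic second-order logic over $k$ and $X$. Here $\mathfrak A_S=k\langle X\rangle/I_S$, where $S$ is extended linearly to the free algebra $k\langle X\rangle$ and $I_S$ is the supremum of all two-sided ideals contained in $\ker S$. Formulas of weighted monadic second-order logic are given by $$\varphi ::= c \mid P_a(x)\mid \neg P_a(x)\mid x\le y\mid \neg(x\le y)\mid x\in Y\mid \neg(x\in Y)\mid \varphi\vee\varphi\mid\varphi\wedge\varphi\mid\exists x.\varphi\mid\exists Y.\varphi\mid\forall x.\varphi\mid\forall Y.\varphi$$ with $c\in k$, $a\in X$. On a word $w\in X^*$, with first-order variables $x$ interpreted as positions of $w$ and second-order variables $Y$ as sets of positions, a formula has a value in $k$: the constant $c$ has value $c$; the atomic formulas and their negations have value $1$ if true and $0$ if false ($P_a(x)$ says that the letter at position $x$ is $a$);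 $\vee$ and $\exists$ are interpreted as sums, $\wedge$ and $\forall$ as products (over all positions, respectively all sets of positions, of $w$). A sentence thus defines a formal series $X^*\to k$. The unambiguous formulas are the smallest class that contains the atomic formulas and their negations, is closed under $\wedge$, $\forall x$, $\forall Y$, contains $\varphi\vee\psi$ whenever $\varphi,\psi$ are unambiguous and never both nonzero, and contains $\exists x.\varphi$ (respectively $\exists Y.\varphi$) whenever $\varphi$ is unambiguous and, for every word and every interpretation of the other variables, nonzero for at most one value of $x$ (respectively $Y$). The almost unambiguous formulas are the closure of the constants and the unambiguous formulas under $\vee$ and $\wedge$. A formula is restricted if, in it, $\forall x$ is applied only to almost unambiguous formulas and $\forall Y$ only to unambiguous formulas. -/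

import Mathlib

/-! ## Formal series and syntactic algebras -/

/-- A formal series `S : X* → k`, i.e. an element of `k⟨⟨X⟩⟩`. -/
abbrev FormalSeries (k X : Type*) := FreeMonoid X → k

/-- The algebra `k⟨X⟩` of noncommutative polynomials: the monoid algebra of the free monoid. -/
abbrev NCPoly (k X : Type*) [Field k] := MonoidAlgebra k (FreeMonoid X)

namespace FormalSeries

variable {k X : Type*} [Field k]

/-- The linear functional `k⟨X⟩ → k` extending `w ↦ S w` linearly. -/
noncomputable def functional (S : FormalSeries k X) : NCPoly k X →ₗ[k] k where
  toFun p := p.coeff.sum fun w c => c * S w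
  map_add' p q := by
    classical
    rw [MonoidAlgebra.coeff_add]
    exact Finsupp.sum_add_index' (by simp) (by intros; ring)
  map_smul' c p := by
    rw [MonoidAlgebra.coeff_smul, Finsupp.sum_smul_index' (by simp), RingHom.id_apply,
      Finsupp.smul_sum]
    simp [mul_assoc]

/-- The syntactic ideal of `S`: the supremum of all two-sided ideals of `k⟨X⟩` contained in the
kernel of `S`. -/
noncomputable def syntacticIdeal (S : FormalSeries k X) : TwoSidedIdeal (NCPoly k X) :=
  sSup {J : TwoSidedIdeal (NCPoly k X) | ∀ p ∈ J, S.functional p = 0}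

/-- The syntactic algebra `k⟨X⟩ / I_S` of `S`. -/
abbrev SyntacticAlgebra (S : FormalSeries k X) := S.syntacticIdeal.ringCon.Quotient

end FormalSeries

/-! ## Weighted monadic second-order logic on words -/

/-- Formulas of weighted monadic second-order logic with weights in `k` over the alphabet `X`,
with free first-order variables among `n` and free second-order variables among `m` de Bruijn
indices. A quantifier binds index `0` of the extended context. Negation is applied to atomic
formulas only. -/
inductive WMSO (k X : Type*) : ℕ → ℕ → Type _
  /-- a weight `c ∈ k` -/
  | const {n m : ℕ} (c : k) : WMSO k X n m
  /-- `P_a(x)`: the letter at position `x` is `a` -/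
  | letter {n m : ℕ} (a : X) (x : Fin n) : WMSO k X n m
  /-- `¬ P_a(x)` -/
  | notLetter {n m : ℕ} (a : X) (x : Fin n) : WMSO k X n m
  /-- `x ≤ y` -/
  | le {n m : ℕ} (x y : Fin n) : WMSO k X n m
  /-- `¬ (x ≤ y)` -/
  | notLe {n m : ℕ} (x y : Fin n) : WMSO k X n m
  /-- `x ∈ Y` -/
  | mem {n m : ℕ} (x : Fin n) (Y : Fin m) : WMSO k X n m
  /-- `¬ (x ∈ Y)` -/
  | notMem {n m : ℕ} (x : Fin n) (Y : Fin m) : WMSO k X n m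
  /-- `φ ∨ ψ` -/
  | or {n m : ℕ} (φ ψ : WMSO k X n m) : WMSO k X n m
  /-- `φ ∧ ψ` -/
  | and {n m : ℕ} (φ ψ : WMSO k X n m) : WMSO k X n m
  /-- `∃ x. φ` -/
  | exFO {n m : ℕ} (φ : WMSO k X (n + 1) m) : WMSO k X n m
  /-- `∃ Y. φ` -/
  | exSO {n m : ℕ} (φ : WMSO k X n (m + 1)) : WMSO k X n m
  /-- `∀ x. φ` -/
  | allFO {n m : ℕ} (φ : WMSO k X (n + 1) m) : WMSO k X n m
  /-- `∀ Y. φ` -/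
  | allSO {n m : ℕ} (φ : WMSO k X n (m + 1)) : WMSO k X n m

namespace WMSO

variable {k X : Type*} [Field k]

open scoped Classical in
/-- The weight of a formula at a word `w`, a position for every free first-order variable and a
set of positions for every free second-order variable: disjunction and existential quantifiers
are sums, conjunction and universal quantifiers are products, over all positions of `w`,
respectively over all sets of positions of `w`. -/
noncomputable def eval (w : List X) : {n m : ℕ} → WMSO k X n m →
    (Fin n → Fin w.length) → (Fin m → Finset (Fin w.length)) → k
  | _, _, const c, _, _ => c
  | _, _, letter a x, σ, _ => if w.get (σ x) = a then 1 else 0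
  | _, _, notLetter a x, σ, _ => if w.get (σ x) = a then 0 else 1
  | _, _, le x y, σ, _ => if σ x ≤ σ y then 1 else 0
  | _, _, notLe x y, σ, _ => if σ x ≤ σ y then 0 else 1
  | _, _, mem x Y, σ, τ => if σ x ∈ τ Y then 1 else 0
  | _, _, notMem x Y, σ, τ => if σ x ∈ τ Y then 0 else 1
  | _, _, or φ ψ, σ, τ => eval w φ σ τ + eval w ψ σ τ
  | _, _, and φ ψ, σ, τ => eval w φ σ τ * eval w ψ σ τ
  | _, _, exFO φ, σ, τ => ∑ i : Fin w.length, eval w φ (Fin.cons i σ) τ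
  | _, _, exSO φ, σ, τ => ∑ I : Finset (Fin w.length), eval w φ σ (Fin.cons I τ)
  | _, _, allFO φ, σ, τ => ∏ i : Fin w.length, eval w φ (Fin.cons i σ) τ
  | _, _, allSO φ, σ, τ => ∏ I : Finset (Fin w.length), eval w φ σ (Fin.cons I τ)

/-- Unambiguous formulas: those built from atomic formulas and their negations by conjunction,
universal quantification, disjunction of formulas with disjoint supports, and existential
quantification where at most one witness has nonzero weight. They take only the values `0`, `1`. -/
inductive Unambiguous : {n m : ℕ} → WMSO k X n m → Prop
  | letter {n m : ℕ} (a : X) (x : Fin n) : Unambiguous (WMSO.letter a x : WMSO k X n m)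
  | notLetter {n m : ℕ} (a : X) (x : Fin n) : Unambiguous (WMSO.notLetter a x : WMSO k X n m)
  | le {n m : ℕ} (x y : Fin n) : Unambiguous (WMSO.le x y : WMSO k X n m)
  | notLe {n m : ℕ} (x y : Fin n) : Unambiguous (WMSO.notLe x y : WMSO k X n m)
  | mem {n m : ℕ} (x : Fin n) (Y : Fin m) : Unambiguous (WMSO.mem x Y : WMSO k X n m)
  | notMem {n m : ℕ} (x : Fin n) (Y : Fin m) : Unambiguous (WMSO.notMem x Y : WMSO k X n m)
  | and {n m : ℕ} {φ ψ : WMSO k X n m} : Unambiguous φ → Unambiguous ψ → Unambiguous (φ.and ψ)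
  | or {n m : ℕ} {φ ψ : WMSO k X n m} : Unambiguous φ → Unambiguous ψ →
      (∀ (w : List X) (σ : Fin n → Fin w.length) (τ : Fin m → Finset (Fin w.length)),
        φ.eval w σ τ = 0 ∨ ψ.eval w σ τ = 0) → Unambiguous (φ.or ψ)
  | exFO {n m : ℕ} {φ : WMSO k X (n + 1) m} : Unambiguous φ →
      (∀ (w : List X) (σ : Fin n → Fin w.length) (τ : Fin m → Finset (Fin w.length))
        (i j : Fin w.length), φ.eval w (Fin.cons i σ) τ ≠ 0 → φ.eval w (Fin.cons j σ) τ ≠ 0 →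
        i = j) → Unambiguous φ.exFO
  | exSO {n m : ℕ} {φ : WMSO k X n (m + 1)} : Unambiguous φ →
      (∀ (w : List X) (σ : Fin n → Fin w.length) (τ : Fin m → Finset (Fin w.length))
        (I J : Finset (Fin w.length)), φ.eval w σ (Fin.cons I τ) ≠ 0 →
        φ.eval w σ (Fin.cons J τ) ≠ 0 → I = J) → Unambiguous φ.exSO
  | allFO {n m : ℕ} {φ : WMSO k X (n + 1) m} : Unambiguous φ → Unambiguous φ.allFO
  | allSO {n m : ℕ} {φ : WMSO k X n (m + 1)} : Unambiguous φ → Unambiguous φ.allSO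

/-- Almost unambiguous formulas: the closure of the weights and the unambiguous formulas under
disjunction and conjunction. -/
inductive AlmostUnambiguous : {n m : ℕ} → WMSO k X n m → Prop
  | const {n m : ℕ} (c : k) : AlmostUnambiguous (WMSO.const c : WMSO k X n m)
  | unambiguous {n m : ℕ} {φ : WMSO k X n m} : Unambiguous φ → AlmostUnambiguous φ
  | or {n m : ℕ} {φ ψ : WMSO k X n m} :
      AlmostUnambiguous φ → AlmostUnambiguous ψ → AlmostUnambiguous (φ.or ψ)
  | and {n m : ℕ} {φ ψ : WMSO k X n m} :
      AlmostUnambiguous φ → AlmostUnambiguous ψ → AlmostUnambiguous (φ.and ψ)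

/-- Restricted formulas: `∀ x` is applied to almost unambiguous formulas only and `∀ Y` to
unambiguous formulas only. (The requirement, over a general semiring, that the weights in the two
parts of a conjunction commute is automatic over a field. Subformulas of an (almost) unambiguous
formula satisfy the two requirements by themselves.) -/
def Restricted : {n m : ℕ} → WMSO k X n m → Prop
  | _, _, const _ => True
  | _, _, letter _ _ => True
  | _, _, notLetter _ _ => True
  | _, _, le _ _ => True
  | _, _, notLe _ _ => True
  | _, _, mem _ _ => True
  | _, _, notMem _ _ => True
  | _, _, or φ ψ => Restricted φ ∧ Restricted ψ
  | _, _, and φ ψ => Restricted φ ∧ Restricted ψ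
  | _, _, exFO φ => Restricted φ
  | _, _, exSO φ => Restricted φ
  | _, _, allFO φ => AlmostUnambiguous φ
  | _, _, allSO φ => Unambiguous φ

/-- The formal series defined by a sentence. -/
noncomputable def series (φ : WMSO k X 0 0) : FormalSeries k X :=
  fun w => φ.eval w.toList Fin.elim0 Fin.elim0

end WMSO

/-- `S` is definable in restricted weighted monadic second-order logic. -/
def FormalSeries.IsRwMSODefinable {k X : Type*} [Field k] (S : FormalSeries k X) : Prop :=
  ∃ φ : WMSO k X 0 0, φ.Restricted ∧ φ.series = S

/-!
A series with finite-dimensional syntactic algebra `A` factors through `A`: the syntactic ideal is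
contained in the kernel of the functional of `S`, so `S w = L (ρ w)` for a linear form `L` on `A`
and the multiplicative extension `ρ` of a map `X → A` (`FormalSeries.exists_representation`).
Writing every product in terms of coordinates turns `S w` into a sum over runs of a weighted
automaton, a run being a choice of one coordinate at each position (`map_mul_prod_eq_sum_runs`).

The states of the automaton are taken to be the subsets of `Fin m`, where `m = dim A`; the `j`-th
basis vector sits at the state `{j}` and all other states carry the vector `0`. A run on `w` is then
the same thing as an arbitrary `m`-tuple of sets of positions of `w`, so the sum over runs is a
block of `m` second-order existential quantifiers, with no condition on the tuple. The weight of a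
run is the weight of its first state times a product over all positions, which is `∀ x` applied to an
almost unambiguous formula (`WMSO.run`). The empty word has no first position and is
treated separately, by a sentence supported on it.
-/

/-! ### Series with finite-dimensional syntactic algebra -/

namespace FormalSeries

variable {k X : Type*} [Field k]

theorem functional_of (S : FormalSeries k X) (w : FreeMonoid X) :
    S.functional (MonoidAlgebra.of k _ w) = S w := by
  simp [functional, MonoidAlgebra.of_apply]

/-- The largest two-sided ideal contained in the kernel of `S`, described elementwise. -/
noncomputable def kernelIdeal (S : FormalSeries k X) : TwoSidedIdeal (NCPoly k X) :=
  TwoSidedIdeal.mk' {p | ∀ a b, S.functional (a * p * b) = 0}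
    (by simp)
    (by intro p q hp hq a b; rw [mul_add, add_mul, map_add, hp, hq, add_zero])
    (by intro p hp a b; rw [mul_neg, neg_mul, map_neg, hp, neg_zero])
    (by intro c p hp a b; rw [← mul_assoc]; exact hp _ _)
    (by intro p c hp a b; rw [← mul_assoc, mul_assoc]; exact hp _ _)

/-- The supremum of the ideals contained in the kernel of `S` is itself contained in it. -/
theorem functional_eq_zero_of_mem (S : FormalSeries k X) {p : NCPoly k X}
    (hp : p ∈ S.syntacticIdeal) : S.functional p = 0 := by
  have hle : S.syntacticIdeal ≤ S.kernelIdeal := by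
    refine sSup_le fun J hJ q hq => ?_
    rw [kernelIdeal, TwoSidedIdeal.mem_mk']
    exact fun a b => hJ _ (J.mul_mem_right _ _ (J.mul_mem_left _ _ hq))
  have h := hle hp
  rw [kernelIdeal, TwoSidedIdeal.mem_mk'] at h
  simpa using h 1 1

/-- A series is a linear form evaluated along a representation in its syntactic algebra. -/
theorem exists_representation (S : FormalSeries k X) {A : Type*} [Ring A] [Algebra k A]
    (e : S.SyntacticAlgebra ≃ₐ[k] A) :
    ∃ (L : A →ₗ[k] k) (ρ : X → A), ∀ w : FreeMonoid X, S w = L (w.toList.map ρ).prod := by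
  let g : NCPoly k X →ₐ[k] A := e.toAlgHom.comp (S.syntacticIdeal.ringCon.mkₐ k)
  have hg : Function.Surjective g :=
    e.surjective.comp (RingCon.mkₐ_surjective (α := k) S.syntacticIdeal.ringCon)
  have hker : ∀ p, g p = 0 → S.functional p = 0 := by
    intro p hp
    refine S.functional_eq_zero_of_mem ?_
    have h0 : S.syntacticIdeal.ringCon.mkₐ k p = S.syntacticIdeal.ringCon.mkₐ k 0 := by
      rw [map_zero]
      exact (map_eq_zero_iff e e.injective).1 hp
    exact (RingCon.eq _).1 h0
  -- since `ker g` lies in the kernel of `S`, composing with a linear section of `g` descends `S`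
  obtain ⟨s, hs⟩ := g.toLinearMap.exists_rightInverse_of_surjective
    (LinearMap.range_eq_top.2 hg)
  have hL : ∀ p, S.functional (s (g p)) = S.functional p := by
    intro p
    rw [← sub_eq_zero, ← map_sub]
    refine hker _ ?_
    rw [map_sub, sub_eq_zero]
    exact LinearMap.congr_fun hs (g p)
  refine ⟨S.functional ∘ₗ s, fun x => g (MonoidAlgebra.of k _ (FreeMonoid.of x)), fun w => ?_⟩
  have hw : (w.toList.map fun x => g (MonoidAlgebra.of k _ (FreeMonoid.of x))).prod =
      g (MonoidAlgebra.of k _ w) := by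
    induction w using FreeMonoid.inductionOn' with
    | one => rw [FreeMonoid.toList_one, map_one, map_one]; rfl
    | of_mul x w ih =>
      rw [FreeMonoid.toList_of_mul, List.map_cons, List.prod_cons, ih, map_mul, map_mul]
  rw [hw, LinearMap.comp_apply, hL, functional_of]

end FormalSeries

/-! ### Sums over runs -/

/-- The weight contributed by position `i` to a run `q` on `w`, where `q i` is the state before
reading position `i`: the weight of the transition to the next state, or, at the last position, the
final weight `F` of reading the last letter. -/
def stepWeight {k X Q : Type*} (T : X → Q → Q → k) (F : X → Q → k) (w : List X)
    (q : Fin w.length → Q) (i : Fin w.length) : k :=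
  if h : (i : ℕ) + 1 < w.length then T (w.get i) (q i) (q ⟨i + 1, h⟩) else F (w.get i) (q i)

/-- If `a = ∑ s, f s a • v s` for all `a`, then expanding a product letter by letter writes any
linear form of it as a sum over runs. -/
theorem map_mul_prod_eq_sum_runs {k X Q A : Type*} [Field k] [Ring A] [Algebra k A] [Fintype Q]
    (L : A →ₗ[k] k) (ρ : X → A) (f : Q → A →ₗ[k] k) (v : Q → A)
    (hfv : ∀ a, ∑ s, f s a • v s = a) (x : X) (l : List X) (a : A) :
    L (a * ((x :: l).map ρ).prod) = ∑ q : Fin (x :: l).length → Q, f (q ⟨0, by simp⟩) a *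
      ∏ i, stepWeight (fun x p s => f s (v p * ρ x)) (fun x p => L (v p * ρ x)) (x :: l) q i := by
  have expand : ∀ a b, L (a * b) = ∑ s, f s a * L (v s * b) := by
    intro a b
    conv_lhs => rw [← hfv a]
    simp [Finset.sum_mul]
  induction l generalizing x a with
  | nil =>
    rw [expand]
    refine (Fintype.sum_equiv (Equiv.funUnique (Fin 1) Q) _ _ fun q => ?_).symm
    simp [stepWeight]
  | cons y l ih =>
    rw [expand]
    refine Eq.trans ?_ ((Fin.consEquiv fun _ : Fin ((y :: l).length + 1) => Q).sum_comp _)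
    rw [Fintype.sum_prod_type]
    refine Finset.sum_congr rfl fun s _ => ?_
    rw [List.map_cons, List.prod_cons, ← mul_assoc, ih y (v s * ρ x), Finset.mul_sum]
    refine Finset.sum_congr rfl fun q _ => ?_
    congr 1
    refine Eq.trans ?_ (Fin.prod_univ_succ (n := (y :: l).length) _).symm
    -- the factors at positions `i.succ` of the longer word agree definitionally with those at `i`
    congr 1
    simp [stepWeight, Fin.consEquiv]
    rfl

/-- Coordinates indexed by the subsets of `Fin (dim A)`: those of a basis at the singletons, and
zero elsewhere. -/
theorem exists_coordinates_finset (k A : Type*) [Field k] [AddCommGroup A] [Module k A]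
    [FiniteDimensional k A] :
    ∃ (m : ℕ) (f : Finset (Fin m) → A →ₗ[k] k) (v : Finset (Fin m) → A),
      ∀ a, ∑ s, f s a • v s = a := by
  let b := Module.finBasis k A
  have hinj : Function.Injective fun j : Fin (Module.finrank k A) => ({j} : Finset _) :=
    Finset.singleton_injective
  refine ⟨_, Function.extend (fun j => {j}) b.coord 0, Function.extend (fun j => {j}) b 0,
    fun a => ?_⟩
  conv_rhs => rw [← b.sum_repr a]
  refine (Fintype.sum_of_injective _ hinj _ _ (fun s hs => ?_) fun j => ?_).symm
  · rw [Function.extend_apply' _ _ _ fun h => hs h]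
    simp
  · rw [hinj.extend_apply, hinj.extend_apply, Module.Basis.coord_apply]

/-! ### Unambiguous formulas -/

namespace WMSO

variable {k X : Type*} [Field k] {n m : ℕ}

/-- `x` is the first position. -/
def first (x : Fin n) : WMSO k X n m := allFO (le x.succ 0)

/-- `x` is the last position. -/
def last (x : Fin n) : WMSO k X n m := allFO (le 0 x.succ)

/-- `y` is the position following `x`. The disjunction `z ≤ x ∨ y ≤ z` is made disjoint. -/
def covBy (x y : Fin n) : WMSO k X n m :=
  and (notLe y x) (allFO (or (le 0 x.succ) (and (notLe 0 x.succ) (le y.succ 0))))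

/-- The sentence that is supported on the empty word. -/
def empty : WMSO k X 0 m := allFO (notLe 0 0)

/-- Conjunction over a list, starting from a true formula about a variable `x`, as `Unambiguous`
admits no constants. -/
def andList {ι : Type*} (x : Fin n) (l : List ι) (φ : ι → WMSO k X n m) : WMSO k X n m :=
  l.foldr (fun i ψ => and (φ i) ψ) (le x x)

/-- The sets of positions that contain `x` are exactly those with index in `s`. -/
def state (s : Finset (Fin m)) (x : Fin n) : WMSO k X n m :=
  andList x (List.finRange m) fun j => if j ∈ s then mem x j else notMem x j

variable (w : List X) (σ : Fin n → Fin w.length) (τ : Fin m → Finset (Fin w.length))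

open scoped Classical in
theorem eval_first (x : Fin n) :
    (first x : WMSO k X n m).eval w σ τ = if ∀ i, σ x ≤ i then 1 else 0 := by
  simp [first, eval, Finset.prod_boole]

open scoped Classical in
theorem eval_last (x : Fin n) :
    (last x : WMSO k X n m).eval w σ τ = if (σ x : ℕ) + 1 < w.length then 0 else 1 := by
  have h : (∀ i, i ≤ σ x) ↔ ¬ (σ x : ℕ) + 1 < w.length := by
    refine ⟨fun h hlt => ?_, fun h i => ?_⟩
    · have := h ⟨σ x + 1, hlt⟩
      simp [Fin.le_def] at this
    · have := i.2
      rw [Fin.le_def]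
      omega
  simp only [last, eval, Fin.cons_zero, Fin.cons_succ, Finset.prod_boole, Finset.mem_univ,
    true_imp_iff, h, ite_not]

theorem eval_covBy (x y : Fin n) :
    (covBy x y : WMSO k X n m).eval w σ τ = if (σ x : ℕ) + 1 = σ y then 1 else 0 := by
  classical
  have hz : ∀ z : Fin w.length, ((if z ≤ σ x then 1 else 0) +
      (if z ≤ σ x then 0 else 1) * (if σ y ≤ z then 1 else 0) : k) =
      if z ≤ σ x ∨ σ y ≤ z then 1 else 0 := by
    intro z
    by_cases h : z ≤ σ x <;> simp [h]
  have h : (¬ σ y ≤ σ x ∧ ∀ z, z ≤ σ x ∨ σ y ≤ z) ↔ (σ x : ℕ) + 1 = σ y := by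
    simp only [Fin.le_def]
    refine ⟨fun ⟨h₁, h₂⟩ => ?_, fun h => ⟨by omega, fun z => by omega⟩⟩
    have := h₂ ⟨σ x + 1, by omega⟩
    simp only at this
    omega
  simp only [covBy, eval, Fin.cons_zero, Fin.cons_succ, hz, Finset.prod_boole, Finset.mem_univ,
    true_imp_iff, ← h]
  by_cases h' : σ y ≤ σ x <;> simp [h']

open scoped Classical in
theorem eval_empty (σ : Fin 0 → Fin w.length) :
    (empty : WMSO k X 0 m).eval w σ τ = if w = [] then 1 else 0 := by
  cases w <;> simp [empty, eval]

theorem eval_andList {ι : Type*} (x : Fin n) (l : List ι) (φ : ι → WMSO k X n m) :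
    (andList x l φ).eval w σ τ = (l.map fun i => (φ i).eval w σ τ).prod := by
  induction l with
  | nil => simp [andList, eval]
  | cons i l ih =>
    rw [List.map_cons, List.prod_cons, ← ih]
    rfl

/-- The indices of the sets that contain a position. -/
def stateAt {w : List X} (τ : Fin m → Finset (Fin w.length)) (i : Fin w.length) :
    Finset (Fin m) :=
  Finset.univ.filter fun j => i ∈ τ j

theorem eval_state (s : Finset (Fin m)) (x : Fin n) :
    (state s x : WMSO k X n m).eval w σ τ = if stateAt τ (σ x) = s then 1 else 0 := by
  have hj : ∀ j, (if j ∈ s then mem x j else notMem x j : WMSO k X n m).eval w σ τ =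
      if (σ x ∈ τ j ↔ j ∈ s) then 1 else 0 := by
    intro j
    by_cases h : j ∈ s <;> simp [h, eval]
  have h : (∀ j, σ x ∈ τ j ↔ j ∈ s) ↔ stateAt τ (σ x) = s := by
    simp [stateAt, Finset.ext_iff]
  simp only [state, eval_andList, hj]
  rw [← List.ofFn_eq_map, List.prod_ofFn, Finset.prod_boole]
  simp [h]

theorem unambiguous_first (x : Fin n) : Unambiguous (first x : WMSO k X n m) :=
  .allFO (.le _ _)

theorem unambiguous_last (x : Fin n) : Unambiguous (last x : WMSO k X n m) :=
  .allFO (.le _ _)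

theorem unambiguous_covBy (x y : Fin n) : Unambiguous (covBy x y : WMSO k X n m) := by
  refine .and (.notLe _ _) (.allFO (.or (.le _ _) (.and (.notLe _ _) (.le _ _)) ?_))
  intro w σ τ
  by_cases h : σ 0 ≤ σ x.succ <;> simp [eval, h]

theorem unambiguous_andList {ι : Type*} (x : Fin n) (l : List ι) {φ : ι → WMSO k X n m}
    (h : ∀ i, Unambiguous (φ i)) : Unambiguous (andList x l φ) := by
  induction l with
  | nil => exact .le _ _
  | cons i l ih => exact .and (h i) ih

theorem unambiguous_state (s : Finset (Fin m)) (x : Fin n) :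
    Unambiguous (state s x : WMSO k X n m) := by
  refine unambiguous_andList _ _ fun j => ?_
  split_ifs
  exacts [.mem _ _, .notMem _ _]

/-- The position following `x` exists and has state `s`. -/
def nextState (s : Finset (Fin m)) (x : Fin n) : WMSO k X n m :=
  exFO (and (covBy x.succ 0) (state s 0))

theorem unambiguous_nextState (s : Finset (Fin m)) (x : Fin n) :
    Unambiguous (nextState s x : WMSO k X n m) := by
  refine .exFO (.and (unambiguous_covBy _ _) (unambiguous_state _ _)) ?_
  intro w σ τ i j hi hj
  simp only [eval, eval_covBy, Fin.cons_zero, Fin.cons_succ, ne_eq, mul_eq_zero, not_or,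
    ite_eq_right_iff, one_ne_zero, imp_false, not_not] at hi hj
  exact Fin.ext (hi.1.symm.trans hj.1)

theorem eval_nextState (s : Finset (Fin m)) (x : Fin n) :
    (nextState s x : WMSO k X n m).eval w σ τ =
      if h : (σ x : ℕ) + 1 < w.length then if stateAt τ ⟨σ x + 1, h⟩ = s then 1 else 0 else 0 := by
  simp only [nextState, eval, eval_covBy, eval_state, Fin.cons_zero, Fin.cons_succ]
  split_ifs with h h'
  · rw [Finset.sum_eq_single ⟨σ x + 1, h⟩]
    · simp [h']
    · intro i _ hi
      rw [if_neg fun h => hi (Fin.ext h.symm), zero_mul]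
    · simp
  · refine Finset.sum_eq_zero fun i _ => ?_
    by_cases hi : (σ x : ℕ) + 1 = i
    · have : i = ⟨σ x + 1, h⟩ := Fin.ext hi.symm
      subst this
      simp [h']
    · simp [hi]
  · refine Finset.sum_eq_zero fun i _ => ?_
    rw [if_neg (by omega), zero_mul]

/-! ### The formula of a weighted automaton -/

/-- Disjunction over a finite type. -/
noncomputable def orAll {ι : Type*} [Fintype ι] (φ : ι → WMSO k X n m) : WMSO k X n m :=
  (Finset.univ.toList (α := ι)).foldr (fun i ψ => or (φ i) ψ) (const 0)

theorem eval_orAll {ι : Type*} [Fintype ι] (φ : ι → WMSO k X n m) :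
    (orAll φ).eval w σ τ = ∑ i, (φ i).eval w σ τ := by
  rw [← Finset.sum_map_toList, orAll]
  induction Finset.univ.toList (α := ι) with
  | nil => simp [eval]
  | cons i l ih => simp [eval, ih]

theorem AlmostUnambiguous.orAll {ι : Type*} [Fintype ι] {φ : ι → WMSO k X n m}
    (h : ∀ i, AlmostUnambiguous (φ i)) : AlmostUnambiguous (orAll φ) := by
  rw [WMSO.orAll]
  induction Finset.univ.toList (α := ι) with
  | nil => exact .const 0
  | cons i l ih => exact .or (h i) ih

theorem Unambiguous.restricted {φ : WMSO k X n m} (h : Unambiguous φ) : φ.Restricted := by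
  induction h with
  | and _ _ ih₁ ih₂ => exact ⟨ih₁, ih₂⟩
  | or _ _ _ ih₁ ih₂ => exact ⟨ih₁, ih₂⟩
  | exFO _ _ ih => exact ih
  | exSO _ _ ih => exact ih
  | allFO h _ => exact .unambiguous h
  | allSO h _ => exact h
  | _ => trivial

theorem AlmostUnambiguous.restricted {φ : WMSO k X n m} (h : AlmostUnambiguous φ) :
    φ.Restricted := by
  induction h with
  | const _ => trivial
  | unambiguous h => exact h.restricted
  | and _ _ ih₁ ih₂ => exact ⟨ih₁, ih₂⟩
  | or _ _ ih₁ ih₂ => exact ⟨ih₁, ih₂⟩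

variable (I : Finset (Fin m) → k) (T : X → Finset (Fin m) → Finset (Fin m) → k)
  (F : X → Finset (Fin m) → k)

/-- The weight `I s`, where `s` is the state at `x`. -/
noncomputable def initial (x : Fin n) : WMSO k X n m :=
  orAll fun s => and (const (I s)) (state s x)

/-- The weight contributed to a run by the position `x`, see `stepWeight`. -/
noncomputable def step [Fintype X] (x : Fin n) : WMSO k X n m :=
  or (orAll fun t : X × Finset (Fin m) × Finset (Fin m) =>
      and (and (const (T t.1 t.2.1 t.2.2)) (letter t.1 x)) (and (state t.2.1 x) (nextState t.2.2 x)))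
    (and (last x) (orAll fun t : X × Finset (Fin m) =>
      and (and (const (F t.1 t.2)) (letter t.1 x)) (state t.2 x)))

theorem eval_initial (x : Fin n) :
    (initial I x : WMSO k X n m).eval w σ τ = I (stateAt τ (σ x)) := by
  simp [initial, eval_orAll, eval, eval_state]

theorem eval_step [Fintype X] (x : Fin n) :
    (step T F x).eval w σ τ = stepWeight T F w (stateAt τ) (σ x) := by
  classical
  simp only [step, eval, eval_orAll, eval_state, eval_nextState, eval_last, stepWeight,
    Fintype.sum_prod_type]
  -- at the last position no next state exists, so exactly one of the two disjuncts contributes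
  split_ifs with h <;> simp

theorem almostUnambiguous_initial (x : Fin n) :
    AlmostUnambiguous (initial I x : WMSO k X n m) :=
  .orAll fun _ => .and (.const _) (.unambiguous (unambiguous_state _ _))

theorem almostUnambiguous_step [Fintype X] (x : Fin n) :
    AlmostUnambiguous (step T F x) :=
  .or (.orAll fun _ => .and (.and (.const _) (.unambiguous (.letter _ _)))
      (.unambiguous (.and (unambiguous_state _ _) (unambiguous_nextState _ _))))
    (.and (.unambiguous (unambiguous_last _)) (.orAll fun _ =>
      .and (.and (.const _) (.unambiguous (.letter _ _))) (.unambiguous (unambiguous_state _ _))))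

/-- The weight of the run encoded by the free second-order variables. -/
noncomputable def run [Fintype X] : WMSO k X 0 m :=
  and (exFO (and (first 0) (initial I 0))) (allFO (step T F 0))

theorem restricted_run [Fintype X] : (run I T F).Restricted :=
  ⟨⟨(unambiguous_first _).restricted, (almostUnambiguous_initial I _).restricted⟩,
    almostUnambiguous_step T F _⟩

theorem eval_run_nil [Fintype X] (σ : Fin 0 → Fin ([] : List X).length)
    (τ : Fin m → Finset (Fin ([] : List X).length)) : (run I T F).eval [] σ τ = 0 := by
  simp [run, eval]

theorem eval_run_cons [Fintype X] (x : X) (l : List X) (σ : Fin 0 → Fin (x :: l).length)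
    (τ : Fin m → Finset (Fin (x :: l).length)) :
    (run I T F).eval (x :: l) σ τ = I (stateAt τ ⟨0, by simp⟩) *
      ∏ i, stepWeight T F (x :: l) (stateAt τ) i := by
  simp only [run, eval, eval_first, eval_initial, eval_step, Fin.cons_zero]
  rw [Finset.sum_eq_single ⟨0, by simp⟩]
  · rw [if_pos fun i => Fin.le_def.2 (Nat.zero_le _), one_mul]
  · intro i _ hi
    rw [if_neg fun h => hi (Fin.ext (Nat.le_zero.1 (h ⟨0, by simp⟩))), zero_mul]
  · simp

/-- Existential closure of all second-order variables. -/
def exClosure : {m : ℕ} → WMSO k X 0 m → WMSO k X 0 0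
  | 0, φ => φ
  | _ + 1, φ => exClosure (exSO φ)

theorem restricted_exClosure {m : ℕ} (φ : WMSO k X 0 m) (h : φ.Restricted) :
    (exClosure φ).Restricted := by
  induction m with
  | zero => exact h
  | succ m ih => exact ih _ h

theorem eval_exClosure {m : ℕ} (φ : WMSO k X 0 m) (w : List X) (σ : Fin 0 → Fin w.length)
    (τ : Fin 0 → Finset (Fin w.length)) :
    (exClosure φ).eval w σ τ = ∑ τ' : Fin m → Finset (Fin w.length), φ.eval w σ τ' := by
  induction m with
  | zero => rw [Fintype.sum_subsingleton _ τ]; rfl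
  | succ m ih =>
    rw [exClosure, ih, ← (Fin.consEquiv fun _ => Finset (Fin w.length)).sum_comp,
      Fintype.sum_prod_type, Finset.sum_comm]
    rfl

/-- Tuples of sets of positions are the same as runs. -/
theorem stateAt_bijective (w : List X) :
    Function.Bijective (stateAt : (Fin m → Finset (Fin w.length)) → _) := by
  refine Function.bijective_iff_has_inverse.2
    ⟨fun q j => Finset.univ.filter fun i => j ∈ q i, fun τ => ?_, fun q => ?_⟩
  · ext; simp [stateAt]
  · ext; simp [stateAt]

end WMSO

/-- A series that is given by a weighted automaton on nonempty words is definable. -/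
theorem FormalSeries.isRwMSODefinable_of_runs {k X : Type*} [Field k] [Finite X]
    (S : FormalSeries k X) {m : ℕ} (I : Finset (Fin m) → k)
    (T : X → Finset (Fin m) → Finset (Fin m) → k) (F : X → Finset (Fin m) → k)
    (hS : ∀ x l, S (FreeMonoid.ofList (x :: l)) =
      ∑ q : Fin (x :: l).length → Finset (Fin m), I (q ⟨0, by simp⟩) *
        ∏ i, stepWeight T F (x :: l) q i) :
    S.IsRwMSODefinable := by
  classical
  have := Fintype.ofFinite X
  refine ⟨.or (.and (.const (S 1)) .empty) (.exClosure (.run I T F)),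
    ⟨⟨trivial, .unambiguous (.notLe _ _)⟩, WMSO.restricted_exClosure _ (WMSO.restricted_run I T F)⟩,
    funext fun w => ?_⟩
  rw [WMSO.series, WMSO.eval, WMSO.eval, WMSO.eval, WMSO.eval_empty, WMSO.eval_exClosure]
  obtain ⟨l, rfl⟩ := FreeMonoid.ofList.surjective w
  rw [FreeMonoid.toList_ofList]
  cases l with
  | nil => simp [WMSO.eval_run_nil]
  | cons x l =>
    rw [if_neg (by simp), mul_zero, zero_add, hS]
    refine Fintype.sum_bijective _ (WMSO.stateAt_bijective (x :: l)) _ _ fun τ => ?_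
    exact WMSO.eval_run_cons I T F x l _ τ

theorem mainTheorem8 {k : Type*} [Field k] [CharZero k]
    (A : Type*) [Ring A] [Algebra k A] [FiniteDimensional k A] [IsSemisimpleRing A]
    {X : Type*} [Finite X] (S : FormalSeries k X)
    (hS : Nonempty (S.SyntacticAlgebra ≃ₐ[k] A)) :
    S.IsRwMSODefinable := by
  obtain ⟨e⟩ := hS
  obtain ⟨L, ρ, hLρ⟩ := S.exists_representation e
  obtain ⟨m, f, v, hfv⟩ := exists_coordinates_finset k A
  refine S.isRwMSODefinable_of_runs (fun s => f s 1) (fun x p s => f s (v p * ρ x))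
    (fun x p => L (v p * ρ x)) fun x l => ?_
  rw [hLρ, FreeMonoid.toList_ofList, ← map_mul_prod_eq_sum_runs L ρ f v hfv, one_mul]
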